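/- Let $I_0=[0,1)$ and let $\mathcal D^4$ be the set of 4-adic intervals $I=[k4^{-n},(k+1)4^{-n})\subset I_0$, $n\ge 0$, $0\le k<4^n$. For $I\in\mathcal D^4$ let $I^y$ be the left half and $I^x$ the right half of $I$, and for $\star\in\{x,y\}$ let $I^\star_-$, $I^\star_+$ be the left and right halves of $I^\star$, so that the four quarters $I^\star_\pm$ of $I$ belong to $\mathcal D^4$. For a family $(U_I)_{I\in\mathcal D^4}$ put $\Delta^\star U_I=\frac12(U_{I^\star_+}-U_{I^\star_-})$. A sliced dyadic supermartingale is a real family $M=(M_I)_{I\in\mathcal D^4}$ with $$M_I\ \ge\ \tfrac12\big(M_{I^x_+}+M_{I^x_-}\big)=\tfrac12\big(M_{I^y_+}+M_{I^y_-}\big)\qquad\text{for all } I\in\mathcal D^4;$$ put $\Delta^{\mathrm{dy}}M_I=\frac12(M_{I^x_+}+M_{I^x_-})-M_I$ and $\|M\|_\infty=\sup_I|M_I|$. The dyadic Hardy space $H^2_{\mathrm{dy}}$ consists of the $f=u+iv$ with $u,v\in L^2(I_0)$ real-valued, whose averages $u_I=\frac1{|I|}\int_I u$, $v_I=\frac1{|I|}\int_I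 v$ are sliced martingales, that is, $\frac12(u_{I^\star_+}+u_{I^\star_-})=u_I$ and $\frac12(v_{I^\star_+}+v_{I^\star_-})=v_I$ for $\star=x,y$, and satisfy the dyadic Cauchy-Riemann equations $\Delta^xu_I=\Delta^yv_I$, $\Delta^yu_I=-\Delta^xv_I$, for all $I\in\mathcal D^4$. Its norm is given by $\|f\|^2=\int_{I_0}(u^2+v^2)$. **Theorem.** (1) Let $M$ be a bounded non-negative sliced dyadic supermartingale and let $\mu_I=-|I|\,\Delta^{\mathrm{dy}}M_I$. Then for all $f=u+iv\in H^2_{\mathrm{dy}}$ $$\sum_{I\in\mathcal D^4}\mu_I\,(u_I^2+v_I^2)\ \le\ e\,\|M\|_\infty\,\|f\|^2 .$$ (2) The constant $e$ in (1) is sharp: for every $C<e$ there are such an $M$ and an $f=u+iv\in H^2_{\mathrm{dy}}$, which can be taken with $v_{I_0}=0$, such that $\sum_{I}\mu_I(u_I^2+v_I^2)>C\,\|M\|_\infty\,\|f\|^2$. (3) Let $\mu=(\mu_I)_{I\in\mathcal D^4}$ be a non-negative sequence with $\sum_{I\in\mathcal D^4}\mu_I<\infty$ which is balanced, that is, for all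 $I\in\mathcal D^4$ $$\frac1{|I^x|}\sum_{J\in\mathcal D^4,\,J\subseteq I^x}\mu_J=\frac1{|I^y|}\sum_{J\in\mathcal D^4,\,J\subseteq I^y}\mu_J=\frac1{|I|}\sum_{J\in\mathcal D^4,\,J\subseteq I}\mu_J-\frac{\mu_I}{|I|},$$ and suppose that $K$ is a packing constant of $\mu$, that is, $\frac1{|I|}\sum_{J\in\mathcal D^4,\,J\subseteq I}\mu_J\le K$ for all $I\in\mathcal D^4$. Then for all $f=u+iv\in H^2_{\mathrm{dy}}$ $$\sum_{I\in\mathcal D^4}\mu_I\,(u_I^2+v_I^2)\ \le\ e\,K\,\|f\|^2 .$$ (4) The constant $e$ in (3) is sharp: for every $C<e$ there are $\mu$ and $K$ as in (3) and an $f=u+iv\in H^2_{\mathrm{dy}}$, which can be taken with $v_{I_0}=0$, such that $\sum_{I}\mu_I(u_I^2+v_I^2)>C\,K\,\|f\|^2$. -/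

import Mathlib

open MeasureTheory

namespace DyadicHardy

/-- A 4-adic subinterval of `I₀ = [0, 1)`: the pair `(n, k)` with `k < 4 ^ n` stands for the interval
`[k 4⁻ⁿ, (k + 1) 4⁻ⁿ)`. -/
@[ext]
structure FourAdic where
  level : ℕ
  pos : ℕ
  pos_lt : pos < 4 ^ level

namespace FourAdic

/-- The interval `I₀ = [0, 1)`. -/
def root : FourAdic := ⟨0, 0, by norm_num⟩

/-- The length `|I|`. -/
noncomputable def length (I : FourAdic) : ℝ := 1 / 4 ^ I.level

/-- The left end point of `I`. -/
noncomputable def left (I : FourAdic) : ℝ := I.pos / 4 ^ I.level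

/-- The set of points of `I`. -/
def toSet (I : FourAdic) : Set ℝ := Set.Ico I.left (I.left + I.length)

/-- The left half `I^y = I_-` of `I`. -/
def yHalf (I : FourAdic) : Set ℝ := Set.Ico I.left (I.left + I.length / 2)

/-- The right half `I^x = I_+` of `I`. -/
def xHalf (I : FourAdic) : Set ℝ := Set.Ico (I.left + I.length / 2) (I.left + I.length)

/-- The quarters of `I`, numbered `0, 1, 2, 3` from left to right. -/
def child (I : FourAdic) (j : Fin 4) : FourAdic :=
  ⟨I.level + 1, 4 * I.pos + j, by
    have h := I.pos_lt
    have hj := j.isLt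
    rw [pow_succ]
    omega⟩

/-- `I^y_-`, the left half of `I^y`. -/
def yMinus (I : FourAdic) : FourAdic := I.child 0

/-- `I^y_+`, the right half of `I^y`. -/
def yPlus (I : FourAdic) : FourAdic := I.child 1

/-- `I^x_-`, the left half of `I^x`. -/
def xMinus (I : FourAdic) : FourAdic := I.child 2

/-- `I^x_+`, the right half of `I^x`. -/
def xPlus (I : FourAdic) : FourAdic := I.child 3

end FourAdic

/-- The mean of `U` over the two children of `I` inside `I^x`. -/
noncomputable def xMean (U : FourAdic → ℝ) (I : FourAdic) : ℝ := (U I.xPlus + U I.xMinus) / 2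

/-- The mean of `U` over the two children of `I` inside `I^y`. -/
noncomputable def yMean (U : FourAdic → ℝ) (I : FourAdic) : ℝ := (U I.yPlus + U I.yMinus) / 2

/-- The increment `Δˣ U_I`. -/
noncomputable def deltaX (U : FourAdic → ℝ) (I : FourAdic) : ℝ := (U I.xPlus - U I.xMinus) / 2

/-- The increment `Δʸ U_I`. -/
noncomputable def deltaY (U : FourAdic → ℝ) (I : FourAdic) : ℝ := (U I.yPlus - U I.yMinus) / 2

/-- Sliced dyadic martingales, indexed by the 4-adic intervals. -/
def IsSlicedMartingale (U : FourAdic → ℝ) : Prop :=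
  ∀ I, xMean U I = U I ∧ yMean U I = U I

/-- Sliced dyadic supermartingales, indexed by the 4-adic intervals. -/
def IsSlicedSupermartingale (M : FourAdic → ℝ) : Prop :=
  ∀ I, xMean M I = yMean M I ∧ xMean M I ≤ M I

/-- The dyadic Laplacian `Δ^dy M_I` of a sliced family (for which `xMean` and `yMean` agree). -/
noncomputable def dyLaplacian (M : FourAdic → ℝ) (I : FourAdic) : ℝ := xMean M I - M I

/-- The weights `μ_I` with `μ_I / |I| = - Δ^dy M_I`. -/
noncomputable def rieszWeight (M : FourAdic → ℝ) (I : FourAdic) : ℝ :=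
  I.length * (-dyLaplacian M I)

/-- The dyadic Cauchy-Riemann equations. -/
def CauchyRiemann (U V : FourAdic → ℝ) : Prop :=
  ∀ I, deltaX U I = deltaY V I ∧ deltaY U I = -deltaX V I

/-- The average `u_I = ⟨u⟩_I` over a 4-adic interval. -/
noncomputable def avg (u : ℝ → ℝ) (I : FourAdic) : ℝ := ⨍ t in I.toSet, u t

/-- Membership of `f = u + i v` in the dyadic Hardy space `H²_dy`; `u` and `v` are the `L²` limits
on `[0, 1)` of the martingales `(u_I)` and `(v_I)`. -/
structure MemHardy (u v : ℝ → ℝ) : Prop where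
  memLp_re : MemLp u 2 (volume.restrict (Set.Ico 0 1))
  memLp_im : MemLp v 2 (volume.restrict (Set.Ico 0 1))
  sliced_re : IsSlicedMartingale (avg u)
  sliced_im : IsSlicedMartingale (avg v)
  cauchyRiemann : CauchyRiemann (avg u) (avg v)

/-- The square of the norm of `f = u + i v` in `H²_dy`. -/
noncomputable def hardyNormSq (u v : ℝ → ℝ) : ℝ := ∫ t in Set.Ico (0 : ℝ) 1, (u t ^ 2 + v t ^ 2)

/-- `∑ μ_J` over the 4-adic intervals `J` contained in `S`. -/
noncomputable def massIn (μ : FourAdic → ℝ) (S : Set ℝ) : ℝ :=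
  ∑' J : {J : FourAdic // J.toSet ⊆ S}, μ J

/-- Balanced non-negative sequences. Summability says that the sums in the balance condition are
finite; it also follows from any packing condition. -/
structure IsBalanced (μ : FourAdic → ℝ) : Prop where
  nonneg : ∀ I, 0 ≤ μ I
  summable : Summable μ
  x_eq_y : ∀ I : FourAdic,
    1 / (I.length / 2) * massIn μ I.xHalf = 1 / (I.length / 2) * massIn μ I.yHalf
  y_eq : ∀ I : FourAdic,
    1 / (I.length / 2) * massIn μ I.yHalf = 1 / I.length * massIn μ I.toSet - μ I / I.length

/-- The packing condition with constant `K`. -/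
def Packing (μ : FourAdic → ℝ) (K : ℝ) : Prop :=
  ∀ I : FourAdic, 1 / I.length * massIn μ I.toSet ≤ K

end DyadicHardy

open DyadicHardy

namespace DyadicHardy

/-! ### The 4-adic tree -/

namespace FourAdic

/-! Write `f = u + iv`. The Cauchy-Riemann equations say that the four children of `I` carry the
values `f_I ± d` and `f_I ± i d`. If `M` moves by `±p` over one half and by `±q` over the other,
then `e^{-M}|f|²` does not decrease in mean (`four_mul_le_sum_exp`), the discrete form of the
subharmonicity of `|f|² e^{-h}` for harmonic `h`.

Normalise to `0 ≤ M ≤ 1` and let `Φ_n` be the integral of `e^{-M}|f|²` over level `n`. The drop of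
`M_I` to the mean of its children raises `e · e^{-M_I}` by at least `-Δ^dy M_I`, because `exp(s) ≥ 1
+ s` and `e · e^{-M} ≥ 1`. Hence `e Φ_n` telescopes and dominates the partial sums, while `Φ_n ≤
‖f‖²` because `M ≥ 0`. Balanced sequences are the same problem: the mean mass of `μ` is a sliced
supermartingale with Riesz weights `μ`.

For sharpness, a walk `k` on `{0, …, N}` with `M = k/N` multiplies `f` by `1 ± tanh(1/2N)` when `k`
moves by `±1`, and by `1 ± i tanh(1/2N)` when it does not. Then the four-point inequality is an
equality, and weighting by `e^{-k/N}|f|²` gives a symmetric lazy walk (`transition_tilted_of_lt`).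
Mass is paid only at the top, where `k` first drops from `N` to `N - 1`. Linear potentials are
harmonic away from the top, which gives the energy and the visits to the top explicitly up to the
unabsorbed part; `exists_contraction` makes that part negligible. The limiting ratio is `e^{1 -
1/N}`, which tends to `e`. -/

theorem length_pos (I : FourAdic) : 0 < I.length := by
  unfold length; positivity

theorem length_child (I : FourAdic) (j : Fin 4) : (I.child j).length = I.length / 4 := by
  simp only [length, child, pow_succ]
  field_simp

theorem left_child (I : FourAdic) (j : Fin 4) :
    (I.child j).left = I.left + j * (I.length / 4) := by
  simp only [length, left, child, pow_succ]
  push_cast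
  field_simp

theorem right_eq (I : FourAdic) : I.left + I.length = (I.pos + 1 : ℝ) / 4 ^ I.level := by
  simp only [length, left]
  ring

/-- The 4-adic intervals are indexed by their level and position. -/
def equivSigma : (Σ n : ℕ, Fin (4 ^ n)) ≃ FourAdic where
  toFun x := ⟨x.1, x.2, x.2.isLt⟩
  invFun I := ⟨I.level, ⟨I.pos, I.pos_lt⟩⟩
  left_inv _ := rfl
  right_inv _ := rfl

/-- The intervals of level less than `n`. -/
def below (n : ℕ) : Finset FourAdic :=
  ((Finset.range n).sigma fun _ => Finset.univ).map equivSigma.toEmbedding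

theorem mem_below {n : ℕ} {I : FourAdic} : I ∈ below n ↔ I.level < n := by
  simp only [below, Finset.mem_map_equiv, Finset.mem_sigma, Finset.mem_range, Finset.mem_univ,
    and_true]
  rfl

theorem exists_subset_below (s : Finset FourAdic) : ∃ n, s ⊆ below n :=
  ⟨s.sup level + 1, fun _ hI => mem_below.2 (Nat.lt_succ_of_le (Finset.le_sup hI))⟩

/-- Backward induction towards the root, for families that are explicit from level `n` on. -/
theorem child_induction {P : FourAdic → Prop} (n : ℕ) (base : ∀ I, n ≤ I.level → P I)
    (step : ∀ I, I.level < n → (∀ j, P (I.child j)) → P I) (I : FourAdic) : P I := by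
  have key : ∀ d, ∀ I : FourAdic, n ≤ I.level + d → P I := by
    intro d
    induction d with
    | zero => exact fun I h => base I h
    | succ d ih =>
      intro I h
      by_cases hI : n ≤ I.level
      · exact base I hI
      · refine step I (by omega) fun j => ih _ ?_
        change n ≤ I.level + 1 + d
        omega
  exact key n I (by omega)

end FourAdic

/-! ### Sums over one level -/

open FourAdic

/-- The sum of `G` over the intervals of level `n`. -/
noncomputable def levelSum (n : ℕ) (G : FourAdic → ℝ) : ℝ :=
  ∑ k : Fin (4 ^ n), G (equivSigma ⟨n, k⟩)

theorem levelSum_zero (G : FourAdic → ℝ) : levelSum 0 G = G root := by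
  have h : ∀ k : Fin (4 ^ 0), G (equivSigma ⟨0, k⟩) = G root := by
    intro k
    congr 1
    ext
    · rfl
    · have := k.isLt
      change (k : ℕ) = 0
      omega
  simp [levelSum, h]

theorem levelSum_succ (n : ℕ) (G : FourAdic → ℝ) :
    levelSum (n + 1) G = levelSum n fun I => ∑ j, G (I.child j) := by
  unfold levelSum
  rw [← Fintype.sum_prod_type',
    ← (finProdFinEquiv.trans (finCongr (pow_succ 4 n).symm)).sum_comp]
  refine Finset.sum_congr rfl fun x _ => congrArg G ?_
  ext
  · rfl
  · simp [equivSigma, child, add_comm]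

theorem levelSum_mono {n : ℕ} {G H : FourAdic → ℝ} (h : ∀ I, I.level = n → G I ≤ H I) :
    levelSum n G ≤ levelSum n H :=
  Finset.sum_le_sum fun _ _ => h _ rfl

theorem levelSum_congr {n : ℕ} {G H : FourAdic → ℝ} (h : ∀ I, I.level = n → G I = H I) :
    levelSum n G = levelSum n H :=
  Finset.sum_congr rfl fun _ _ => h _ rfl

theorem levelSum_nonneg {n : ℕ} {G : FourAdic → ℝ} (h : ∀ I, I.level = n → 0 ≤ G I) :
    0 ≤ levelSum n G :=
  Finset.sum_nonneg fun _ _ => h _ rfl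

theorem levelSum_add (n : ℕ) (G H : FourAdic → ℝ) :
    levelSum n (fun I => G I + H I) = levelSum n G + levelSum n H :=
  Finset.sum_add_distrib

theorem levelSum_const_mul (n : ℕ) (c : ℝ) (G : FourAdic → ℝ) :
    levelSum n (fun I => c * G I) = c * levelSum n G :=
  (Finset.mul_sum _ _ _).symm

theorem sum_below (n : ℕ) (G : FourAdic → ℝ) :
    ∑ I ∈ below n, G I = ∑ m ∈ Finset.range n, levelSum m G := by
  rw [below, Finset.sum_map, Finset.sum_sigma]
  rfl

/-! ### Integrals and averages -/

theorem measurableSet_toSet (I : FourAdic) : MeasurableSet I.toSet := measurableSet_Ico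

theorem toSet_root : root.toSet = Set.Ico 0 1 := by
  simp [toSet, root, left, length]

theorem volume_toSet (I : FourAdic) : volume.real I.toSet = I.length := by
  simp [toSet, I.length_pos.le]

theorem toSet_subset_root (I : FourAdic) : I.toSet ⊆ Set.Ico 0 1 := by
  apply Set.Ico_subset_Ico
  · simp only [left]; positivity
  · rw [right_eq, div_le_one (by positivity)]
    exact_mod_cast I.pos_lt

theorem integral_toSet_eq_sum {w : ℝ → ℝ} (hw : IntegrableOn w (Set.Ico 0 1)) (I : FourAdic) :
    ∫ t in I.toSet, w t = ∑ j, ∫ t in (I.child j).toSet, w t := by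
  have hl := I.length_pos
  have hI : IntegrableOn w (Set.Ico I.left (I.left + I.length)) :=
    hw.mono_set (toSet_subset_root I)
  have split : ∀ a b c : ℝ, I.left ≤ a → a ≤ b → b ≤ c → c ≤ I.left + I.length →
      ∫ t in Set.Ico a c, w t = (∫ t in Set.Ico a b, w t) + ∫ t in Set.Ico b c, w t := by
    intro a b c h1 h2 h3 h4
    rw [← Set.Ico_union_Ico_eq_Ico h2 h3]
    refine setIntegral_union ?_ measurableSet_Ico (hI.mono_set ?_) (hI.mono_set ?_)
    · exact Set.Ico_disjoint_Ico_same
    · exact Set.Ico_subset_Ico h1 (h3.trans h4)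
    · exact Set.Ico_subset_Ico (h1.trans h2) h4
  simp only [Fin.sum_univ_four, toSet, left_child, length_child]
  rw [split _ (I.left + I.length / 4) _ le_rfl (by linarith) (by linarith) le_rfl,
    split _ (I.left + 2 * (I.length / 4)) _ (by linarith) (by linarith) (by linarith) le_rfl,
    split (I.left + 2 * (I.length / 4)) (I.left + 3 * (I.length / 4)) _ (by linarith)
      (by linarith) (by linarith) le_rfl]
  simp only [Fin.isValue, Fin.coe_ofNat_eq_mod, Nat.zero_mod, Nat.one_mod, Nat.reduceMod,
    Nat.cast_zero, Nat.cast_one, Nat.cast_ofNat]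
  ring_nf

theorem levelSum_integral {w : ℝ → ℝ} (hw : IntegrableOn w (Set.Ico 0 1)) (n : ℕ) :
    levelSum n (fun I => ∫ t in I.toSet, w t) = ∫ t in Set.Ico (0 : ℝ) 1, w t := by
  induction n with
  | zero => rw [levelSum_zero, toSet_root]
  | succ n ih =>
    rw [levelSum_succ, ← ih]
    exact levelSum_congr fun I _ => (integral_toSet_eq_sum hw I).symm

theorem length_mul_avg (u : ℝ → ℝ) (I : FourAdic) :
    I.length * avg u I = ∫ t in I.toSet, u t := by
  rw [avg, setAverage_eq, volume_toSet, smul_eq_mul, mul_inv_cancel_left₀ I.length_pos.ne']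

theorem avg_eq_sum {u : ℝ → ℝ} (hu : IntegrableOn u (Set.Ico 0 1)) (I : FourAdic) :
    avg u I = (∑ j, avg u (I.child j)) / 4 := by
  have h := integral_toSet_eq_sum hu I
  simp only [← length_mul_avg, length_child, ← Finset.mul_sum] at h
  have hl := I.length_pos.ne'
  field_simp at h ⊢
  linarith

theorem avg_eq_of_eqOn {u : ℝ → ℝ} {c : ℝ} {I : FourAdic} (h : ∀ t ∈ I.toSet, u t = c) :
    avg u I = c := by
  have h1 := length_mul_avg u I
  rw [setIntegral_congr_fun (measurableSet_toSet I) h, setIntegral_const, volume_toSet,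
    smul_eq_mul] at h1
  exact mul_left_cancel₀ I.length_pos.ne' h1

/-- Jensen's inequality, from the non-negativity of the variance of `u` on `I`. -/
theorem length_mul_avg_sq_le {u : ℝ → ℝ} (hu : MemLp u 2 (volume.restrict (Set.Ico 0 1)))
    (I : FourAdic) : I.length * avg u I ^ 2 ≤ ∫ t in I.toSet, u t ^ 2 := by
  have hle := Measure.restrict_mono_set (volume : Measure ℝ) (toSet_subset_root I)
  have h2 : MemLp u 2 (volume.restrict I.toSet) := hu.mono_measure hle
  have hfin : IsFiniteMeasure (volume.restrict I.toSet) := by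
    refine ⟨?_⟩
    simp [toSet]
  have hi : Integrable u (volume.restrict I.toSet) := h2.integrable (by norm_num)
  have hsq := h2.integrable_sq
  set c := avg u I
  have h0 : 0 ≤ ∫ t in I.toSet, (u t - c) ^ 2 := integral_nonneg fun t => sq_nonneg _
  have hexp : ∫ t in I.toSet, (u t - c) ^ 2
      = (∫ t in I.toSet, u t ^ 2) - 2 * c * (I.length * c) + I.length * c ^ 2 := by
    have : ∀ t, (u t - c) ^ 2 = u t ^ 2 - 2 * c * u t + c ^ 2 := fun t => by ring
    simp only [this]
    have hci := hi.const_mul (2 * c)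
    rw [integral_add (f := fun t => u t ^ 2 - 2 * c * u t) (hsq.sub hci) (integrable_const _),
      integral_sub hsq hci, integral_const_mul, ← length_mul_avg]
    simp [volume_toSet, c, length_mul_avg]
  nlinarith

theorem MemHardy.integrable_sq_add {u v : ℝ → ℝ} (h : MemHardy u v) :
    IntegrableOn (fun t => u t ^ 2 + v t ^ 2) (Set.Ico 0 1) :=
  h.memLp_re.integrable_sq.add h.memLp_im.integrable_sq

theorem MemHardy.levelSum_le {u v : ℝ → ℝ} (h : MemHardy u v) (n : ℕ) :
    levelSum n (fun I => I.length * (avg u I ^ 2 + avg v I ^ 2)) ≤ hardyNormSq u v := by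
  rw [hardyNormSq, ← levelSum_integral h.integrable_sq_add n]
  refine levelSum_mono fun I _ => ?_
  have hsub := toSet_subset_root I
  rw [integral_add (IntegrableOn.mono_set h.memLp_re.integrable_sq hsub)
    (IntegrableOn.mono_set h.memLp_im.integrable_sq hsub), mul_add]
  exact add_le_add (length_mul_avg_sq_le h.memLp_re I) (length_mul_avg_sq_le h.memLp_im I)

/-! ### Inclusion between intervals and masses -/

/-- Scaling the end points by `4 ^ J.level` turns inclusion into inequalities between natural
numbers, so that the splitting of an interval into halves and quarters is left to `omega`. -/
theorem toSet_subset_iff {J : FourAdic} {m p q : ℕ} (hm : m ≤ J.level) :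
    J.toSet ⊆ Set.Ico ((p : ℝ) / 4 ^ m) (q / 4 ^ m) ↔
      p * 4 ^ (J.level - m) ≤ J.pos ∧ J.pos + 1 ≤ q * 4 ^ (J.level - m) := by
  have hpow : (4 : ℝ) ^ J.level = 4 ^ m * 4 ^ (J.level - m) := by
    rw [← pow_add, Nat.add_sub_cancel' hm]
  have h4 : (0 : ℝ) < 4 ^ m := by positivity
  have h4' : (0 : ℝ) < 4 ^ (J.level - m) := by positivity
  rw [toSet, Set.Ico_subset_Ico_iff (by linarith [J.length_pos]), right_eq, left, hpow]
  rw [div_le_div_iff₀ h4 (by positivity), div_le_div_iff₀ (by positivity) h4]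
  refine and_congr ?_ ?_
  · rw [← mul_assoc, mul_right_comm, mul_comm (J.pos : ℝ), mul_comm _ ((4 : ℝ) ^ m),
      mul_le_mul_iff_right₀ h4]
    exact_mod_cast Iff.rfl
  · rw [← mul_assoc, mul_right_comm, mul_comm (_ + 1 : ℝ), mul_comm _ ((4 : ℝ) ^ m),
      mul_le_mul_iff_right₀ h4]
    exact_mod_cast Iff.rfl

theorem level_le_of_subset {I J : FourAdic} (h : J.toSet ⊆ I.toSet) : I.level ≤ J.level := by
  have h1 := (Set.Ico_subset_Ico_iff (by linarith [J.length_pos])).1 h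
  have h2 : J.length ≤ I.length := by linarith [h1.1, h1.2]
  rw [length, length, div_le_div_iff_of_pos_left one_pos (by positivity) (by positivity)] at h2
  exact (pow_le_pow_iff_right₀ (by norm_num)).1 h2

theorem level_lt_of_subset_half {I J : FourAdic} {a : ℝ}
    (h : J.toSet ⊆ Set.Ico a (a + I.length / 2)) : I.level < J.level := by
  have h1 := (Set.Ico_subset_Ico_iff (by linarith [J.length_pos])).1 h
  have h2 : J.length < I.length := by linarith [h1.1, h1.2, I.length_pos]
  rw [length, length, div_lt_div_iff_of_pos_left one_pos (by positivity) (by positivity)] at h2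
  exact (pow_lt_pow_iff_right₀ (by norm_num)).1 h2

theorem toSet_eq (I : FourAdic) :
    I.toSet = Set.Ico ((I.pos : ℝ) / 4 ^ I.level) ((I.pos + 1 : ℕ) / 4 ^ I.level) := by
  rw [toSet, right_eq, left]
  push_cast
  rfl

theorem child_toSet_subset_iff {I J : FourAdic} {j : Fin 4} :
    J.toSet ⊆ (I.child j).toSet ↔ I.level + 1 ≤ J.level ∧
      (4 * I.pos + j) * 4 ^ (J.level - (I.level + 1)) ≤ J.pos ∧
      J.pos + 1 ≤ (4 * I.pos + j + 1) * 4 ^ (J.level - (I.level + 1)) := by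
  refine ⟨fun h => ?_, fun ⟨h, h'⟩ => ?_⟩
  · have hl := level_le_of_subset h
    rw [toSet_eq (I.child j), toSet_subset_iff hl] at h
    exact ⟨hl, h⟩
  · rw [toSet_eq (I.child j), toSet_subset_iff (m := (I.child j).level) h]
    exact h'

theorem level_succ_subset_iff {I J : FourAdic} (h : I.level + 1 ≤ J.level) :
    J.toSet ⊆ I.toSet ↔
      4 * I.pos * 4 ^ (J.level - (I.level + 1)) ≤ J.pos ∧
      J.pos + 1 ≤ (4 * I.pos + 4) * 4 ^ (J.level - (I.level + 1)) := by
  rw [toSet_eq I, toSet_subset_iff (by omega),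
    show J.level - I.level = J.level - (I.level + 1) + 1 by omega, pow_succ]
  constructor <;> rintro ⟨h1, h2⟩ <;> constructor <;> linarith

theorem eq_of_subset_of_level {I J : FourAdic} (h : J.toSet ⊆ I.toSet) (hl : J.level ≤ I.level) :
    J = I := by
  have hl' := level_le_of_subset h
  rw [toSet_eq I, toSet_subset_iff hl', Nat.sub_eq_zero_of_le hl] at h
  ext <;> omega

theorem subset_xHalf_iff {I J : FourAdic} :
    J.toSet ⊆ I.xHalf ↔ J.toSet ⊆ I.xMinus.toSet ∨ J.toSet ⊆ I.xPlus.toSet := by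
  have hx : I.xHalf = Set.Ico ((4 * I.pos + 2 : ℕ) / 4 ^ (I.level + 1) : ℝ)
      ((4 * I.pos + 4 : ℕ) / 4 ^ (I.level + 1)) := by
    rw [xHalf, right_eq, left, length, pow_succ]
    push_cast
    congr 1
    · field_simp
      ring
    · field_simp
  have key : J.toSet ⊆ I.xHalf → I.level + 1 ≤ J.level := by
    intro h
    refine level_lt_of_subset_half (a := I.left + I.length / 2) ?_
    rwa [add_assoc, add_halves]
  by_cases hl : I.level + 1 ≤ J.level
  · rw [xMinus, xPlus, child_toSet_subset_iff, child_toSet_subset_iff, hx, toSet_subset_iff hl]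
    simp only [hl, true_and, Fin.isValue, Fin.coe_ofNat_eq_mod, Nat.reduceMod, add_mul]
    omega
  · rw [xMinus, xPlus, child_toSet_subset_iff, child_toSet_subset_iff]
    tauto

theorem subset_yHalf_iff {I J : FourAdic} :
    J.toSet ⊆ I.yHalf ↔ J.toSet ⊆ I.yMinus.toSet ∨ J.toSet ⊆ I.yPlus.toSet := by
  have hx : I.yHalf = Set.Ico ((4 * I.pos : ℕ) / 4 ^ (I.level + 1) : ℝ)
      ((4 * I.pos + 2 : ℕ) / 4 ^ (I.level + 1)) := by
    rw [yHalf, left, length, pow_succ]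
    push_cast
    congr 1
    · field_simp
    · field_simp
      ring
  have key : J.toSet ⊆ I.yHalf → I.level + 1 ≤ J.level := level_lt_of_subset_half
  by_cases hl : I.level + 1 ≤ J.level
  · rw [yMinus, yPlus, child_toSet_subset_iff, child_toSet_subset_iff, hx, toSet_subset_iff hl]
    simp only [hl, true_and, Fin.isValue, Fin.coe_ofNat_eq_mod, Nat.reduceMod, add_mul]
    omega
  · rw [yMinus, yPlus, child_toSet_subset_iff, child_toSet_subset_iff]
    tauto

theorem subset_iff_halves {I J : FourAdic} :
    J.toSet ⊆ I.toSet ↔ J = I ∨ J.toSet ⊆ I.yHalf ∨ J.toSet ⊆ I.xHalf := by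
  have hl := I.length_pos
  constructor
  · intro h
    rcases Nat.lt_or_ge I.level J.level with hl | hl
    · right
      rw [level_succ_subset_iff hl] at h
      simp only [subset_yHalf_iff, subset_xHalf_iff, yMinus, yPlus, xMinus, xPlus,
        child_toSet_subset_iff]
      simp only [Nat.succ_le_of_lt hl, true_and, Fin.isValue, Fin.coe_ofNat_eq_mod, Nat.reduceMod,
        add_mul] at h ⊢
      omega
    · exact Or.inl (eq_of_subset_of_level h hl)
  · rintro (rfl | h | h)
    · exact subset_rfl
    · exact h.trans (Set.Ico_subset_Ico_right (by linarith))
    · exact h.trans (Set.Ico_subset_Ico_left (by linarith))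

theorem not_subset_of_disjoint {J : FourAdic} {S T : Set ℝ} (h : Disjoint S T)
    (hS : J.toSet ⊆ S) : ¬ J.toSet ⊆ T := fun hT => by
  have hJ : J.left ∈ J.toSet := ⟨le_rfl, by linarith [J.length_pos]⟩
  exact Set.disjoint_left.1 h (hS hJ) (hT hJ)

theorem massIn_union {μ : FourAdic → ℝ} (hμ : Summable μ) {S T R : Set ℝ} (h : Disjoint S T)
    (hR : ∀ J : FourAdic, J.toSet ⊆ R ↔ J.toSet ⊆ S ∨ J.toSet ⊆ T) :
    massIn μ R = massIn μ S + massIn μ T := by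
  have hu : {J : FourAdic | J.toSet ⊆ R} = {J | J.toSet ⊆ S} ∪ {J | J.toSet ⊆ T} := by
    ext J; exact hR J
  have hd : Disjoint {J : FourAdic | J.toSet ⊆ S} {J | J.toSet ⊆ T} :=
    Set.disjoint_left.2 fun J hS hT => not_subset_of_disjoint h hS hT
  change ∑' J : ({J : FourAdic | J.toSet ⊆ R} : Set FourAdic), μ J = _
  rw [hu]
  exact (hμ.subtype _).tsum_union_disjoint hd (hμ.subtype _)

theorem massIn_xHalf {μ : FourAdic → ℝ} (hμ : Summable μ) (I : FourAdic) :
    massIn μ I.xHalf = massIn μ I.xMinus.toSet + massIn μ I.xPlus.toSet := by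
  refine massIn_union hμ ?_ fun J => subset_xHalf_iff
  simp only [xMinus, xPlus, toSet, left_child, length_child]
  refine Set.disjoint_left.2 fun x h1 h2 => ?_
  have h3 := h1.2
  have h4 := h2.1
  norm_num at h3 h4
  linarith

theorem massIn_yHalf {μ : FourAdic → ℝ} (hμ : Summable μ) (I : FourAdic) :
    massIn μ I.yHalf = massIn μ I.yMinus.toSet + massIn μ I.yPlus.toSet := by
  refine massIn_union hμ ?_ fun J => subset_yHalf_iff
  simp only [yMinus, yPlus, toSet, left_child, length_child]
  refine Set.Ico_disjoint_Ico.2 ?_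
  simp

theorem massIn_toSet {μ : FourAdic → ℝ} (hμ : Summable μ) (I : FourAdic) :
    massIn μ I.toSet = μ I + (massIn μ I.yHalf + massIn μ I.xHalf) := by
  have hl := I.length_pos
  have hdisj : Disjoint I.yHalf I.xHalf := Set.Ico_disjoint_Ico_same
  have hu : {J : FourAdic | J.toSet ⊆ I.toSet} =
      {I} ∪ ({J | J.toSet ⊆ I.yHalf} ∪ {J | J.toSet ⊆ I.xHalf}) := by
    ext J; exact subset_iff_halves
  have h1 : Disjoint {J : FourAdic | J.toSet ⊆ I.yHalf} {J | J.toSet ⊆ I.xHalf} :=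
    Set.disjoint_left.2 fun J hS hT => not_subset_of_disjoint hdisj hS hT
  have h2 : Disjoint {I}
      ({J : FourAdic | J.toSet ⊆ I.yHalf} ∪ {J | J.toSet ⊆ I.xHalf}) := by
    refine Set.disjoint_singleton_left.2 ?_
    rintro (h | h)
    · exact lt_irrefl _ (level_lt_of_subset_half h)
    · refine lt_irrefl _ (level_lt_of_subset_half (I := I) (a := I.left + I.length / 2) ?_)
      rwa [add_assoc, add_halves]
  change ∑' J : ({J : FourAdic | J.toSet ⊆ I.toSet} : Set FourAdic), μ J = _
  rw [hu, (hμ.subtype _).tsum_union_disjoint h2 (hμ.subtype _),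
    (hμ.subtype _).tsum_union_disjoint h1 (hμ.subtype _), tsum_singleton]
  rfl

theorem massIn_nonneg {μ : FourAdic → ℝ} (hμ : ∀ I, 0 ≤ μ I) (S : Set ℝ) : 0 ≤ massIn μ S :=
  tsum_nonneg fun J => hμ J

/-! ### The embedding theorem -/

/-- With `z = u + iv` and `d = a - ib` the four points are `z ± d` and `z ± id`. Expanding in `cosh`
and `sinh`, the claim becomes `2X ≤ (P + Q - 2)F + (P + Q)D`, where `X` pairs `(s, r)` with the real
and imaginary parts of `(u + iv)(a + ib)`. Cauchy-Schwarz bounds `X`, and the inequality of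
arithmetic and geometric means bounds the right side from below. -/
theorem four_mul_le_sum_exp (a b u v p q : ℝ) :
    4 * (u ^ 2 + v ^ 2) ≤
      Real.exp (-p) * ((u + a) ^ 2 + (v - b) ^ 2) + Real.exp p * ((u - a) ^ 2 + (v + b) ^ 2) +
      (Real.exp (-q) * ((u + b) ^ 2 + (v + a) ^ 2) +
        Real.exp q * ((u - b) ^ 2 + (v - a) ^ 2)) := by
  have hp := Real.cosh_sq p
  have hq := Real.cosh_sq q
  have hp1 := Real.one_le_cosh p
  have hq1 := Real.one_le_cosh q
  rw [← Real.cosh_sub_sinh p, ← Real.cosh_add_sinh p, ← Real.cosh_sub_sinh q,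
    ← Real.cosh_add_sinh q]
  generalize Real.cosh p = P at *
  generalize Real.cosh q = Q at *
  generalize Real.sinh p = s at *
  generalize Real.sinh q = r at *
  set F := u ^ 2 + v ^ 2 with hF
  set D := a ^ 2 + b ^ 2 with hD
  set X := s * (u * a - v * b) + r * (u * b + v * a) with hX
  have hF0 : 0 ≤ F := by positivity
  have hD0 : 0 ≤ D := by positivity
  have hcs : X ^ 2 ≤ (s ^ 2 + r ^ 2) * (F * D) := by
    have : (s ^ 2 + r ^ 2) * (F * D) - X ^ 2
        = (s * (u * b + v * a) - r * (u * a - v * b)) ^ 2 := by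
      rw [hX, hF, hD]; ring
    nlinarith [sq_nonneg (s * (u * b + v * a) - r * (u * a - v * b))]
  have hY : 0 ≤ (P + Q - 2) * F + (P + Q) * D :=
    add_nonneg (mul_nonneg (by linarith) hF0) (mul_nonneg (by linarith) hD0)
  have hsq : (2 * X) ^ 2 ≤ ((P + Q - 2) * F + (P + Q) * D) ^ 2 := by
    -- Since `s² = P² - 1` and `r² = Q² - 1`, this is `(P - 1)(Q - 1) ≥ 0`.
    have h1 : s ^ 2 + r ^ 2 ≤ (P + Q - 2) * (P + Q) := by
      nlinarith [mul_nonneg (sub_nonneg.2 hp1) (sub_nonneg.2 hq1)]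
    have h2 := mul_le_mul_of_nonneg_right h1 (mul_nonneg hF0 hD0)
    nlinarith [sq_nonneg ((P + Q - 2) * F - (P + Q) * D)]
  have := le_of_abs_le (abs_le_of_sq_le_sq hsq hY)
  rw [hX, hF, hD] at this
  nlinarith

/-- Around the common mean of its two slices `M` has symmetric increments, so the four-point
inequality applies after factoring out `exp (-xMean M I)`. -/
theorem sum_child_exp_ge {M U V : FourAdic → ℝ} (hM : IsSlicedSupermartingale M)
    (hU : IsSlicedMartingale U) (hV : IsSlicedMartingale V) (hUV : CauchyRiemann U V)
    (I : FourAdic) :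
    4 * (Real.exp (-xMean M I) * (U I ^ 2 + V I ^ 2)) ≤
      ∑ j, Real.exp (-M (I.child j)) * (U (I.child j) ^ 2 + V (I.child j) ^ 2) := by
  have h1 := four_mul_le_sum_exp (deltaX U I) (deltaY U I) (U I) (V I) (deltaX M I) (deltaY M I)
  have hM1 := (hM I).1
  have hu := hU I
  have hv := hV I
  have hc := hUV I
  have ex : ∀ x, Real.exp (-(xMean M I + x)) = Real.exp (-xMean M I) * Real.exp (-x) := by
    intro x; rw [← Real.exp_add]; ring_nf
  have e0 : M (I.child 0) = xMean M I + -deltaY M I := by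
    rw [hM1]; simp only [yMean, deltaY, yPlus, yMinus]; ring
  have e1 : M (I.child 1) = xMean M I + deltaY M I := by
    rw [hM1]; simp only [yMean, deltaY, yPlus, yMinus]; ring
  have e2 : M (I.child 2) = xMean M I + -deltaX M I := by
    simp only [xMean, deltaX, xPlus, xMinus]; ring
  have e3 : M (I.child 3) = xMean M I + deltaX M I := by
    simp only [xMean, deltaX, xPlus, xMinus]; ring
  have hx : ∀ W : FourAdic → ℝ, xMean W I = W I → W (I.child 2) = W I - deltaX W I ∧
      W (I.child 3) = W I + deltaX W I := by
    intro W h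
    simp only [xMean, deltaX, xPlus, xMinus] at h ⊢
    constructor <;> linarith
  have hy : ∀ W : FourAdic → ℝ, yMean W I = W I → W (I.child 0) = W I - deltaY W I ∧
      W (I.child 1) = W I + deltaY W I := by
    intro W h
    simp only [yMean, deltaY, yPlus, yMinus] at h ⊢
    constructor <;> linarith
  rw [Fin.sum_univ_four, e0, e1, e2, e3, ex, ex, ex, ex, (hx U hu.1).1, (hx U hu.1).2,
    (hy U hu.2).1, (hy U hu.2).2, (hx V hv.1).1, (hx V hv.1).2, (hy V hv.2).1, (hy V hv.2).2,
    ← hc.1, show deltaX V I = -deltaY U I by linarith [hc.2], neg_neg, neg_neg]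
  have h2 := mul_le_mul_of_nonneg_left h1 (Real.exp_pos (-xMean M I)).le
  refine le_trans (le_of_eq ?_) (h2.trans (le_of_eq ?_)) <;> ring

theorem rieszWeight_nonneg {M : FourAdic → ℝ} (hM : IsSlicedSupermartingale M) (I : FourAdic) :
    0 ≤ rieszWeight M I := by
  have := (hM I).2
  exact mul_nonneg I.length_pos.le (by rw [dyLaplacian]; linarith)

theorem levelSum_rieszWeight_le {M U V : FourAdic → ℝ} (hM : IsSlicedSupermartingale M)
    (hM1 : ∀ I, M I ≤ 1) (hU : IsSlicedMartingale U) (hV : IsSlicedMartingale V)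
    (hUV : CauchyRiemann U V) (n : ℕ) :
    levelSum n (fun I => rieszWeight M I * (U I ^ 2 + V I ^ 2)) +
      Real.exp 1 * levelSum n (fun I => I.length * (Real.exp (-M I) * (U I ^ 2 + V I ^ 2))) ≤
      Real.exp 1 * levelSum (n + 1)
        (fun I => I.length * (Real.exp (-M I) * (U I ^ 2 + V I ^ 2))) := by
  rw [levelSum_succ, ← levelSum_const_mul, ← levelSum_const_mul, ← levelSum_add]
  refine levelSum_mono fun I _ => ?_
  simp only [length_child, ← Finset.mul_sum]
  have h1 := sum_child_exp_ge hM hU hV hUV I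
  have hl := I.length_pos
  set F := U I ^ 2 + V I ^ 2 with hF
  have hF0 : 0 ≤ F := by positivity
  have h2 : 1 - dyLaplacian M I ≤ Real.exp (-dyLaplacian M I) := by
    linarith [Real.add_one_le_exp (-dyLaplacian M I)]
  have h3 : Real.exp (-xMean M I) = Real.exp (-M I) * Real.exp (-dyLaplacian M I) := by
    rw [← Real.exp_add, dyLaplacian]; ring_nf
  -- The only use of `M ≤ 1`; it is what makes the constant `e`.
  have h4 : 1 ≤ Real.exp 1 * Real.exp (-M I) := by
    rw [← Real.exp_add]
    exact Real.one_le_exp (by linarith [hM1 I])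
  have h5 : 0 ≤ -dyLaplacian M I := by rw [dyLaplacian]; linarith [(hM I).2]
  have h6 : -dyLaplacian M I + Real.exp 1 * Real.exp (-M I) ≤
      Real.exp 1 * Real.exp (-xMean M I) := by
    rw [h3, ← mul_assoc]
    nlinarith [mul_le_mul_of_nonneg_left h2 (zero_le_one.trans h4), mul_nonneg h5 (sub_nonneg.2 h4)]
  have h7 := mul_le_mul_of_nonneg_left h6 (mul_nonneg hl.le hF0)
  have h8 := mul_le_mul_of_nonneg_left h1
    (mul_nonneg (Real.exp_pos 1).le (div_nonneg hl.le (by norm_num : (0 : ℝ) ≤ 4)))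
  rw [rieszWeight]
  calc _ = I.length * F * (-dyLaplacian M I + Real.exp 1 * Real.exp (-M I)) := by ring
    _ ≤ _ := h7
    _ = Real.exp 1 * (I.length / 4) * (4 * (Real.exp (-xMean M I) * F)) := by ring
    _ ≤ _ := h8
    _ = _ := by ring

/-- The one-level inequality telescopes to `e Φ n`; then `exp (-M) ≤ 1` and Jensen replace `Φ n` by
the norm. -/
theorem sum_below_rieszWeight_le {M : FourAdic → ℝ} (hM : IsSlicedSupermartingale M)
    (hM0 : ∀ I, 0 ≤ M I) (hM1 : ∀ I, M I ≤ 1) {u v : ℝ → ℝ} (h : MemHardy u v) (n : ℕ) :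
    ∑ I ∈ below n, rieszWeight M I * (avg u I ^ 2 + avg v I ^ 2) ≤
      Real.exp 1 * hardyNormSq u v := by
  set Φ : ℕ → ℝ := fun n =>
    levelSum n (fun I => I.length * (Real.exp (-M I) * (avg u I ^ 2 + avg v I ^ 2))) with hΦ
  have key : ∀ n, ∑ m ∈ Finset.range n,
      levelSum m (fun I => rieszWeight M I * (avg u I ^ 2 + avg v I ^ 2)) ≤
      Real.exp 1 * Φ n := by
    intro n
    induction n with
    | zero =>
      rw [Finset.sum_range_zero]
      refine mul_nonneg (Real.exp_pos 1).le (levelSum_nonneg fun I _ => ?_)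
      have := I.length_pos
      positivity
    | succ n ih =>
      rw [Finset.sum_range_succ]
      have := levelSum_rieszWeight_le hM hM1 h.sliced_re h.sliced_im h.cauchyRiemann n
      simp only [hΦ] at ih ⊢
      linarith
  rw [sum_below]
  refine (key n).trans (mul_le_mul_of_nonneg_left ?_ (Real.exp_pos 1).le)
  refine le_trans (levelSum_mono fun I _ => ?_) (h.levelSum_le n)
  refine mul_le_mul_of_nonneg_left ?_ I.length_pos.le
  exact mul_le_of_le_one_left (by positivity) (Real.exp_le_one_iff.2 (by linarith [hM0 I]))

theorem summable_and_tsum_le_of_sum_below_le {g : FourAdic → ℝ} {c : ℝ} (hg : ∀ I, 0 ≤ g I)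
    (h : ∀ n, ∑ I ∈ below n, g I ≤ c) : Summable g ∧ ∑' I, g I ≤ c := by
  have h' : ∀ s : Finset FourAdic, ∑ I ∈ s, g I ≤ c := fun s => by
    obtain ⟨n, hn⟩ := exists_subset_below s
    exact (Finset.sum_le_sum_of_subset_of_nonneg hn fun I _ _ => hg I).trans (h n)
  exact ⟨summable_of_sum_le hg h', (summable_of_sum_le hg h').tsum_le_of_sum_le h'⟩

theorem embedding_of_le_one {M : FourAdic → ℝ} (hM : IsSlicedSupermartingale M)
    (hM0 : ∀ I, 0 ≤ M I) (hM1 : ∀ I, M I ≤ 1) {u v : ℝ → ℝ} (h : MemHardy u v) :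
    Summable (fun I => rieszWeight M I * (avg u I ^ 2 + avg v I ^ 2)) ∧
      ∑' I, rieszWeight M I * (avg u I ^ 2 + avg v I ^ 2) ≤ Real.exp 1 * hardyNormSq u v :=
  summable_and_tsum_le_of_sum_below_le
    (fun I => mul_nonneg (rieszWeight_nonneg hM I) (by positivity))
    (sum_below_rieszWeight_le hM hM0 hM1 h)

theorem embedding_of_le {M : FourAdic → ℝ} (hM : IsSlicedSupermartingale M)
    (hM0 : ∀ I, 0 ≤ M I) {K : ℝ} (hMK : ∀ I, M I ≤ K) {u v : ℝ → ℝ} (h : MemHardy u v) :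
    Summable (fun I => rieszWeight M I * (avg u I ^ 2 + avg v I ^ 2)) ∧
      ∑' I, rieszWeight M I * (avg u I ^ 2 + avg v I ^ 2) ≤
        Real.exp 1 * K * hardyNormSq u v := by
  -- The proof divides by `K`, so `K = 0` is separate; then `M` and its weights vanish.
  rcases ((hM0 root).trans (hMK root)).eq_or_lt with hK | hK
  · have hz : ∀ I, M I = 0 := fun I => le_antisymm (hK ▸ hMK I) (hM0 I)
    have hw : ∀ I, rieszWeight M I = 0 := fun I => by
      simp [rieszWeight, dyLaplacian, xMean, hz]
    simp [hw, ← hK, summable_zero]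
  · have hx : ∀ I, xMean (fun I => M I / K) I = xMean M I / K := fun I => by
      simp only [xMean]; ring
    have hy : ∀ I, yMean (fun I => M I / K) I = yMean M I / K := fun I => by
      simp only [yMean]; ring
    have h1 := embedding_of_le_one (M := fun I => M I / K)
      (fun I => by
        rw [hx, hy]
        exact ⟨by rw [(hM I).1], div_le_div_of_nonneg_right (hM I).2 hK.le⟩)
      (fun I => div_nonneg (hM0 I) hK.le) (fun I => (div_le_one hK).2 (hMK I)) h
    have hw : ∀ I, rieszWeight M I * (avg u I ^ 2 + avg v I ^ 2) =
        K * (rieszWeight (fun I => M I / K) I * (avg u I ^ 2 + avg v I ^ 2)) := fun I => by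
      rw [rieszWeight, rieszWeight, dyLaplacian, dyLaplacian, hx]
      field_simp
    simp only [hw]
    refine ⟨h1.1.mul_left K, ?_⟩
    rw [tsum_mul_left]
    calc _ ≤ K * (Real.exp 1 * hardyNormSq u v) := mul_le_mul_of_nonneg_left h1.2 hK.le
      _ = _ := by ring

/-! ### Balanced sequences -/

/-- The mean mass `∑_{J ⊆ I} μ_J / |I|`. -/
noncomputable def meanMass (μ : FourAdic → ℝ) (I : FourAdic) : ℝ :=
  1 / I.length * massIn μ I.toSet

theorem meanMass_nonneg {μ : FourAdic → ℝ} (hμ : ∀ I, 0 ≤ μ I) (I : FourAdic) :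
    0 ≤ meanMass μ I :=
  mul_nonneg (one_div_nonneg.2 I.length_pos.le) (massIn_nonneg hμ _)

theorem xMean_meanMass {μ : FourAdic → ℝ} (hμ : Summable μ) (I : FourAdic) :
    xMean (meanMass μ) I = 1 / (I.length / 2) * massIn μ I.xHalf := by
  rw [massIn_xHalf hμ]
  simp only [xMean, meanMass, xPlus, xMinus, length_child]
  have := I.length_pos
  field_simp
  ring

theorem yMean_meanMass {μ : FourAdic → ℝ} (hμ : Summable μ) (I : FourAdic) :
    yMean (meanMass μ) I = 1 / (I.length / 2) * massIn μ I.yHalf := by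
  rw [massIn_yHalf hμ]
  simp only [yMean, meanMass, yPlus, yMinus, length_child]
  have := I.length_pos
  field_simp
  ring

/-- The balance condition says that the mean masses of the two halves agree and lie below that of
`I` by `μ I / I.length`. -/
theorem IsBalanced.isSlicedSupermartingale {μ : FourAdic → ℝ} (hμ : IsBalanced μ) :
    IsSlicedSupermartingale (meanMass μ) := by
  intro I
  have h : xMean (meanMass μ) I = yMean (meanMass μ) I := by
    rw [xMean_meanMass hμ.summable, yMean_meanMass hμ.summable, hμ.x_eq_y]
  refine ⟨h, ?_⟩
  rw [h, yMean_meanMass hμ.summable, hμ.y_eq, meanMass]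
  linarith [div_nonneg (hμ.nonneg I) I.length_pos.le]

theorem IsBalanced.rieszWeight_meanMass {μ : FourAdic → ℝ} (hμ : IsBalanced μ) :
    rieszWeight (meanMass μ) = μ := by
  ext I
  rw [rieszWeight, dyLaplacian, xMean_meanMass hμ.summable, hμ.x_eq_y, hμ.y_eq, meanMass]
  have := I.length_pos
  field_simp
  ring

/-- A Riesz decomposition: since `M` vanishes from level `n` on, it has no martingale part and is
the potential of its weights. The mass formula passes from children to parent. -/
theorem massIn_rieszWeight {M : FourAdic → ℝ} (hM : IsSlicedSupermartingale M) {n : ℕ}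
    (hn : ∀ I, n ≤ I.level → M I = 0) (hs : Summable (rieszWeight M)) (I : FourAdic) :
    massIn (rieszWeight M) I.toSet = I.length * M I := by
  induction I using child_induction n with
  | base I hI =>
    have h0 : ∀ J : {J : FourAdic // J.toSet ⊆ I.toSet}, rieszWeight M J = 0 := by
      rintro ⟨J, hJ⟩
      have hl : n ≤ J.level := hI.trans (level_le_of_subset hJ)
      have hc : ∀ j, M (J.child j) = 0 := fun j => hn _ (hl.trans (Nat.le_succ _))
      simp [rieszWeight, dyLaplacian, xMean, xPlus, xMinus, hc, hn J hl]
    rw [massIn, tsum_congr h0, tsum_zero, hn I hI, mul_zero]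
  | step I _ ih =>
    rw [massIn_toSet hs, massIn_xHalf hs, massIn_yHalf hs, yMinus, yPlus, xMinus, xPlus, ih, ih,
      ih, ih]
    have h := (hM I).1
    simp only [rieszWeight, dyLaplacian, xMean, yMean, yMinus, yPlus, xMinus, xPlus,
      length_child] at h ⊢
    linear_combination (I.length / -2) * h

theorem isBalanced_rieszWeight {M : FourAdic → ℝ} (hM : IsSlicedSupermartingale M) {n : ℕ}
    (hn : ∀ I, n ≤ I.level → M I = 0) :
    IsBalanced (rieszWeight M) ∧ meanMass (rieszWeight M) = M := by
  have hs : Summable (rieszWeight M) := by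
    refine summable_of_ne_finset_zero (s := below n) fun I hI => ?_
    have hl : n ≤ I.level := by rwa [mem_below, not_lt] at hI
    have hc : ∀ j, M (I.child j) = 0 := fun j => hn _ (hl.trans (Nat.le_succ _))
    simp [rieszWeight, dyLaplacian, xMean, xPlus, xMinus, hc, hn I hl]
  have hm : meanMass (rieszWeight M) = M := by
    ext I
    rw [meanMass, massIn_rieszWeight hM hn hs, one_div, inv_mul_cancel_left₀ I.length_pos.ne']
  refine ⟨⟨rieszWeight_nonneg hM, hs, fun I => ?_, fun I => ?_⟩, hm⟩
  · rw [← xMean_meanMass hs, ← yMean_meanMass hs, hm, (hM I).1]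
  · rw [← yMean_meanMass hs, ← meanMass, hm, ← (hM I).1, rieszWeight, dyLaplacian,
      mul_div_cancel_left₀ _ I.length_pos.ne']
    ring

/-! ### The extremal example -/

/-- The exponential of the step size `1 / N`. -/
noncomputable def growth (N : ℕ) : ℝ := Real.exp (1 / N)

/-- The relative size `tanh (1 / 2N)` of the increments. -/
noncomputable def tilt (N : ℕ) : ℝ := (growth N - 1) / (growth N + 1)

/-- One step of the walk: a state `(k, z)` stands for `M_I = k / N`, `f_I = z`. The value `0` is
absorbing, and from `N` the first coordinate drops by one before it moves. -/
noncomputable def walkStep (N : ℕ) (s : ℕ × ℂ) (j : ℕ) : ℕ × ℂ :=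
  if s.1 = 0 then s else
    match j with
    | 0 => (min s.1 (N - 1), s.2 * (1 - tilt N * Complex.I))
    | 1 => (min s.1 (N - 1), s.2 * (1 + tilt N * Complex.I))
    | 2 => (min s.1 (N - 1) - 1, s.2 * (1 - tilt N))
    | _ => (min s.1 (N - 1) + 1, s.2 * (1 + tilt N))

/-- The walk started at `(N, 1)` and stopped at level `n`, indexed by level and position. -/
noncomputable def walk (N n : ℕ) : ℕ → ℕ → ℕ × ℂ
  | 0, _ => (N, 1)
  | m + 1, p =>
    if m < n then walkStep N (walk N n m (p / 4)) (p % 4) else (0, (walk N n m (p / 4)).2)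

/-- The state of the walk at the interval `I`. -/
noncomputable def state (N n : ℕ) (I : FourAdic) : ℕ × ℂ := walk N n I.level I.pos

variable {N n : ℕ}

theorem state_root : state N n root = (N, 1) := rfl

theorem state_child (I : FourAdic) (j : Fin 4) : state N n (I.child j) =
    if I.level < n then walkStep N (state N n I) j else (0, (state N n I).2) := by
  have h1 : (4 * I.pos + j) / 4 = I.pos := by omega
  have h2 : (4 * I.pos + j) % 4 = j := by omega
  simp only [state, child, walk, h1, h2]

theorem one_lt_growth (hN : 0 < N) : 1 < growth N :=
  Real.one_lt_exp_iff.2 (by positivity)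

theorem growth_pow (hN : 0 < N) : growth N ^ N = Real.exp 1 := by
  rw [growth, ← Real.exp_nat_mul]
  congr 1
  field_simp

theorem walk_fst_le (hN : 2 ≤ N) (m p : ℕ) : (walk N n m p).1 ≤ N := by
  induction m generalizing p with
  | zero => exact le_rfl
  | succ m ih =>
    have := ih (p / 4)
    simp only [walk, walkStep]
    split_ifs
    · exact this
    · split <;> simp only <;> omega
    · exact Nat.zero_le _

theorem state_fst_le (hN : 2 ≤ N) (I : FourAdic) : (state N n I).1 ≤ N := walk_fst_le hN _ _

theorem state_fst_eq_zero {I : FourAdic} (h : n < I.level) : (state N n I).1 = 0 := by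
  obtain ⟨m, p, hp⟩ := I
  cases m with
  | zero => exact absurd h (Nat.not_lt_zero _)
  | succ m =>
    have : ¬ m < n := by simp only at h; omega
    simp [state, walk, this]

/-! The transition operator. -/

/-- The rate of the walk weighted by `exp (-k / N) |z|²`. -/
noncomputable def rate (N : ℕ) : ℝ := growth N / (growth N + 1) ^ 2

/-- The transition operator of the walk weighted by `|z|²`. -/
noncomputable def transition (N : ℕ) (φ : ℕ → ℝ) (k : ℕ) : ℝ :=
  if k = 0 then φ 0 else
    (1 - 2 * rate N) * φ (min k (N - 1)) + rate N * growth N * φ (min k (N - 1) + 1) +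
      rate N / growth N * φ (min k (N - 1) - 1)

/-- With `x = growth N` one has `1 + tilt N = 2x / (x + 1)` and `1 - tilt N = 2 / (x + 1)`; the
squared moduli of the four factors are then the coefficients of `transition`. -/
theorem sum_walkStep (φ : ℕ → ℝ) (s : ℕ × ℂ) :
    ∑ j : Fin 4, φ (walkStep N s j).1 * Complex.normSq (walkStep N s j).2 =
      4 * (transition N φ s.1 * Complex.normSq s.2) := by
  have hx : 0 < growth N := Real.exp_pos _
  have hx1 : growth N + 1 ≠ 0 := by positivity
  by_cases hs : s.1 = 0
  · simp [walkStep, transition, hs]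
  · rw [Fin.sum_univ_four]
    simp only [walkStep, transition, hs, if_false, Fin.isValue, Fin.coe_ofNat_eq_mod,
      Nat.zero_mod, Nat.one_mod, Nat.reduceMod, map_mul]
    have n0 : Complex.normSq (1 - tilt N * Complex.I) = 1 + tilt N ^ 2 := by
      simp [Complex.normSq_apply]; ring
    have n1 : Complex.normSq (1 + tilt N * Complex.I) = 1 + tilt N ^ 2 := by
      simp [Complex.normSq_apply]; ring
    have n2 : Complex.normSq (1 - tilt N) = (1 - tilt N) ^ 2 := by
      simp [Complex.normSq_apply]; ring
    have n3 : Complex.normSq (1 + tilt N) = (1 + tilt N) ^ 2 := by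
      simp [Complex.normSq_apply]; ring
    rw [n0, n1, n2, n3]
    have t0 : 1 + tilt N ^ 2 = 2 * (1 - 2 * rate N) := by
      rw [tilt, rate]; field_simp; ring
    have t1 : (1 + tilt N) ^ 2 = 4 * (rate N * growth N) := by
      rw [tilt, rate]; field_simp; ring
    have t2 : (1 - tilt N) ^ 2 = 4 * (rate N / growth N) := by
      rw [tilt, rate]; field_simp; ring
    rw [t0, t1, t2]
    ring

/-- The integral of `φ (k) |z|²` over the states at level `m`. -/
noncomputable def walkMean (N n m : ℕ) (φ : ℕ → ℝ) : ℝ :=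
  levelSum m fun I => I.length * (φ (state N n I).1 * Complex.normSq (state N n I).2)

theorem walkMean_zero (φ : ℕ → ℝ) : walkMean N n 0 φ = φ N := by
  rw [walkMean, levelSum_zero, state_root]
  simp [length, root]

theorem walkMean_succ {m : ℕ} (hm : m < n) (φ : ℕ → ℝ) :
    walkMean N n (m + 1) φ = walkMean N n m (transition N φ) := by
  rw [walkMean, levelSum_succ]
  refine levelSum_congr fun I hI => ?_
  simp only [state_child, hI, hm, if_true, length_child, ← Finset.mul_sum, sum_walkStep]
  ring

theorem walkMean_mono (hN : 2 ≤ N) (m : ℕ) {φ ψ : ℕ → ℝ} (h : ∀ k ≤ N, φ k ≤ ψ k) :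
    walkMean N n m φ ≤ walkMean N n m ψ :=
  levelSum_mono fun I _ => mul_le_mul_of_nonneg_left
    (mul_le_mul_of_nonneg_right (h _ (state_fst_le hN I)) (Complex.normSq_nonneg _))
    I.length_pos.le

theorem walkMean_add_mul (m : ℕ) (φ ψ : ℕ → ℝ) (c d : ℝ) :
    walkMean N n m (fun k => c * φ k + d * ψ k) =
      c * walkMean N n m φ + d * walkMean N n m ψ := by
  simp only [walkMean, ← levelSum_const_mul, ← levelSum_add]
  exact levelSum_congr fun I _ => by ring

theorem walkMean_mul (m : ℕ) (φ : ℕ → ℝ) (c : ℝ) :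
    walkMean N n m (fun k => c * φ k) = c * walkMean N n m φ := by
  simpa using walkMean_add_mul (N := N) (n := n) m φ φ c 0

/-! ### The tilted walk and its potential theory -/

/-- The potential `exp (-k / N) g(k)`. -/
noncomputable def tilted (N : ℕ) (g : ℕ → ℝ) (k : ℕ) : ℝ := (growth N)⁻¹ ^ k * g k

/-- The indicator function of the top state `k = N`. -/
noncomputable def top (N k : ℕ) : ℝ := if k = N then 1 else 0

theorem transition_tilted_zero (g : ℕ → ℝ) : transition N (tilted N g) 0 = g 0 := by
  simp [transition, tilted]

/-- The factor `exp (-k / N)` cancels the asymmetry of the rates `rate * growth` and `rate /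
growth`, leaving a symmetric lazy walk. -/
theorem transition_tilted_of_lt (g : ℕ → ℝ) {k : ℕ} (hk : k + 1 < N) :
    transition N (tilted N g) (k + 1) =
      (growth N)⁻¹ ^ (k + 1) * (g (k + 1) + rate N * (g (k + 2) + g k - 2 * g (k + 1))) := by
  have hx : growth N ≠ 0 := (Real.exp_pos _).ne'
  have h : min (k + 1) (N - 1) = k + 1 := by omega
  simp only [transition, tilted, h, Nat.succ_ne_zero, if_false, Nat.add_sub_cancel]
  simp only [inv_pow, pow_succ]
  field_simp
  ring

/-- The forced drop from `N` to `N - 1` costs one extra factor `growth`. Writing `N = k + 2` keeps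
the natural subtractions exact. -/
theorem transition_tilted_top (g : ℕ → ℝ) (k : ℕ) :
    transition (k + 2) (tilted (k + 2) g) (k + 2) =
      (growth (k + 2))⁻¹ ^ (k + 2) * (growth (k + 2) * (g (k + 1) +
        rate (k + 2) * (g (k + 2) + g k - 2 * g (k + 1)))) := by
  have hx : growth (k + 2) ≠ 0 := (Real.exp_pos _).ne'
  have h : min (k + 2) (k + 2 - 1) = k + 1 := by omega
  simp only [transition, tilted, h, Nat.succ_ne_zero, if_false, Nat.add_sub_cancel]
  simp only [inv_pow, pow_succ]
  field_simp
  ring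

/-- Second differences of a linear function vanish, so only the forced drop at the top contributes.
-/
theorem transition_tilted_linear (hN : 2 ≤ N) (a b : ℝ) {k : ℕ} (hk : k ≤ N) :
    transition N (tilted N fun k => a + b * k) k = 1 * tilted N (fun k => a + b * k) k +
      (growth N)⁻¹ ^ N * (growth N * (a + b * (N - 1)) - (a + b * N)) * top N k := by
  obtain ⟨l, rfl⟩ := Nat.exists_eq_add_of_le' hN
  rcases hk.eq_or_lt with rfl | hk
  · rw [transition_tilted_top]
    simp only [tilted, top, if_true]
    push_cast
    ring
  · cases k with
    | zero => simp [transition_tilted_zero, tilted, top]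
    | succ k =>
      rw [transition_tilted_of_lt _ hk]
      simp only [tilted, top, hk.ne, if_false]
      push_cast
      ring

theorem walkMean_linear (hN : 2 ≤ N) (a b : ℝ) {m : ℕ} (hm : m ≤ n) :
    walkMean N n m (tilted N fun k => a + b * k) = (growth N)⁻¹ ^ N * ((a + b * N) +
      (growth N * (a + b * (N - 1)) - (a + b * N)) *
        ∑ i ∈ Finset.range m, walkMean N n i (top N)) := by
  induction m with
  | zero => simp [walkMean_zero, tilted]
  | succ m ih =>
    rw [walkMean_succ hm, Finset.sum_range_succ]
    have : walkMean N n m (transition N (tilted N fun k => a + b * k)) =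
        walkMean N n m (fun k => 1 * tilted N (fun k => a + b * k) k +
          (growth N)⁻¹ ^ N * (growth N * (a + b * (N - 1)) - (a + b * N)) * top N k) :=
      le_antisymm (walkMean_mono hN m fun k hk => (transition_tilted_linear hN a b hk).le)
        (walkMean_mono hN m fun k hk => (transition_tilted_linear hN a b hk).ge)
    rw [this, walkMean_add_mul, ih (by omega)]
    ring

/-- The defect `N - exp (1 / N) (N - 1)` of the linear potential at the top. -/
noncomputable def defect (N : ℕ) : ℝ := N - growth N * (N - 1)

/-- This is `1 - 1 / N < exp (-1 / N)`, multiplied by `N * growth N`. -/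
theorem defect_pos (hN : 2 ≤ N) : 0 < defect N := by
  have hN' : (0 : ℝ) < N := by positivity
  have h : (1 : ℝ) - 1 / N < Real.exp (-(1 / N)) := by
    have := Real.add_one_lt_exp (x := -(1 / (N : ℝ))) (by simp; omega)
    linarith
  have h2 : growth N * Real.exp (-(1 / N)) = 1 := by
    rw [growth, ← Real.exp_add, add_neg_cancel, Real.exp_zero]
  have h3 := mul_lt_mul_of_pos_left h (mul_pos hN' (Real.exp_pos (1 / (N : ℝ))))
  rw [← growth, mul_assoc, mul_assoc, h2] at h3
  have h4 : (N : ℝ) * (growth N * (1 - 1 / N)) = growth N * (N - 1) := by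
    field_simp
  rw [defect]
  linarith

/-- The potential `k` only loses at the top. Subtracting a small multiple of `k²` makes it strictly
concave, so it loses a fixed proportion in the interior too, while remaining comparable to `k`. -/
theorem exists_contraction (hN : 2 ≤ N) : ∃ (c : ℝ) (g : ℕ → ℝ), 0 ≤ c ∧ c < 1 ∧
    (∀ k ≤ N, (k : ℝ) ≤ 2 * g k) ∧
    ∀ k ≤ N, transition N (tilted N g) k ≤ c * tilted N g k := by
  have hN' : (2 : ℝ) ≤ N := by exact_mod_cast hN
  have hx := one_lt_growth (N := N) (by omega)
  have hr : 0 < rate N := by unfold rate; positivity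
  set W := defect N with hW
  have hW0 : 0 < W := defect_pos hN
  have hxW : growth N * (N - 1) = N - W := by rw [hW, defect]; ring
  have hWN : W < N := by nlinarith
  -- Chosen so that `g N = N - W / 2`, still above the bound `N - W` for the value after the forced
  -- drop.
  set ε := W / (2 * N ^ 2) with hε
  have hε0 : 0 < ε := by positivity
  have hεN : ε * N ^ 2 = W / 2 := by rw [hε]; field_simp
  have hεN' : ε * N ≤ 1 / 2 := by nlinarith
  -- The first entry is the ratio needed at the top; the second comes from the interior loss `2 *
  -- rate N * ε` and `g ≤ N`.
  set c := max ((N - W) / (N - W / 2)) (1 - 2 * rate N * ε / N) with hc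
  have hc0 : 0 ≤ c := le_max_of_le_left (div_nonneg (by linarith) (by linarith))
  refine ⟨c, fun k => k - ε * k ^ 2, hc0, max_lt ?_ ?_, fun k hk => ?_, fun k hk => ?_⟩
  · rw [div_lt_one (by linarith)]; linarith
  · have : 0 < 2 * rate N * ε / N := by positivity
    linarith
  · have hk' : (k : ℝ) ≤ N := by exact_mod_cast hk
    have h1 : ε * k ≤ 1 / 2 := (mul_le_mul_of_nonneg_left hk' hε0.le).trans hεN'
    have h2 := mul_le_mul_of_nonneg_right h1 k.cast_nonneg
    simp only
    nlinarith
  · rcases hk.eq_or_lt with rfl | hk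
    · obtain ⟨l, rfl⟩ := Nat.exists_eq_add_of_le' hN
      rw [transition_tilted_top, tilted, mul_left_comm c]
      refine mul_le_mul_of_nonneg_left ?_ (by positivity)
      have h1 : ((l + 2 : ℕ) : ℝ) - W ≤ c * ((l + 2 : ℕ) - W / 2) :=
        (div_le_iff₀ (by linarith)).1 (le_max_left _ _)
      rw [← hεN] at h1
      refine le_trans ?_ h1
      rw [← hxW]
      refine mul_le_mul_of_nonneg_left ?_ (by linarith)
      push_cast
      nlinarith [mul_pos hr hε0, mul_nonneg hε0.le (sq_nonneg ((l : ℝ) + 1))]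
    · cases k with
      | zero => simp [transition_tilted_zero, tilted]
      | succ k =>
        rw [transition_tilted_of_lt _ hk, tilted, mul_left_comm c]
        refine mul_le_mul_of_nonneg_left ?_ (by positivity)
        have hk' : ((k + 1 : ℕ) : ℝ) ≤ N := by exact_mod_cast hk.le
        have h1 : 1 - 2 * rate N * ε / N ≤ c := le_max_right _ _
        have h2 : ε * ((k + 1 : ℕ) : ℝ) ≤ 1 / 2 :=
          (mul_le_mul_of_nonneg_left hk' hε0.le).trans hεN'
        have hk0 : (0 : ℝ) < (k + 1 : ℕ) := by positivity
        have h3 : (0 : ℝ) ≤ (k + 1 : ℕ) - ε * (k + 1 : ℕ) ^ 2 := by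
          nlinarith [mul_le_mul_of_nonneg_right h2 hk0.le]
        refine le_trans ?_ (mul_le_mul_of_nonneg_right h1 h3)
        have h4 : ((k + 1 : ℕ) : ℝ) - ε * (k + 1 : ℕ) ^ 2 ≤ N := by
          nlinarith [mul_nonneg hε0.le (sq_nonneg ((k + 1 : ℕ) : ℝ))]
        have h5 : 2 * rate N * ε / N * ((k + 1 : ℕ) - ε * (k + 1 : ℕ) ^ 2) ≤ 2 * rate N * ε := by
          rw [div_mul_eq_mul_div, div_le_iff₀ (by linarith)]
          exact mul_le_mul_of_nonneg_left h4 (by positivity)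
        have h6 : rate N * (((k + 2 : ℕ) - ε * (k + 2 : ℕ) ^ 2) + (k - ε * k ^ 2)
            - 2 * ((k + 1 : ℕ) - ε * (k + 1 : ℕ) ^ 2)) = -(2 * rate N * ε) := by
          push_cast; ring
        rw [h6, sub_mul]
        linarith

/-- The part of the walk not yet absorbed at level `n` is negligible for large `n`. The form `0 + 1
* k` is the linear potential with `a = 0`, `b = 1`. -/
theorem exists_walkMean_lt (hN : 2 ≤ N) {η : ℝ} (hη : 0 < η) :
    ∃ n, walkMean N n n (tilted N fun k => 0 + 1 * k) < η := by
  obtain ⟨c, g, hc0, hc1, hg, hP⟩ := exists_contraction hN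
  have hx : 0 < growth N := Real.exp_pos _
  have key : ∀ n m, m ≤ n → walkMean N n m (tilted N g) ≤ c ^ m * tilted N g N := by
    intro n m hm
    induction m with
    | zero => simp [walkMean_zero]
    | succ m ih =>
      rw [walkMean_succ hm]
      refine (walkMean_mono hN m hP).trans ?_
      rw [walkMean_mul, pow_succ', mul_assoc]
      exact mul_le_mul_of_nonneg_left (ih (by omega)) hc0
  have hlim : Filter.Tendsto (fun n : ℕ => 2 * (c ^ n * tilted N g N)) Filter.atTop
      (nhds (2 * (0 * tilted N g N))) :=
    ((tendsto_pow_atTop_nhds_zero_of_lt_one hc0 hc1).mul_const _).const_mul _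
  obtain ⟨n, hn⟩ := (hlim.eventually (gt_mem_nhds (show 2 * (0 * tilted N g N) < η by simpa using hη))).exists
  refine ⟨n, lt_of_le_of_lt ?_ hn⟩
  refine le_trans ?_ (mul_le_mul_of_nonneg_left (key n n le_rfl) zero_le_two)
  rw [← walkMean_mul]
  refine walkMean_mono hN n fun k hk => ?_
  simp only [tilted]
  rw [mul_left_comm, zero_add, one_mul]
  exact mul_le_mul_of_nonneg_left (hg k hk) (by positivity)

/-- On the integers `0, …, N`, `exp (k / N) ≤ 1 + (e - 1) k`: both sides are `1` at `k = 0`, and for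
`k ≥ 1` the left is at most `e`. Equality at the absorbing state confines the excess to unabsorbed
mass. -/
theorem walkMean_one_le (hN : 2 ≤ N) (n : ℕ) : walkMean N n n (fun _ => 1) ≤
    walkMean N n n (tilted N fun k => 1 + (Real.exp 1 - 1) * k) := by
  refine walkMean_mono hN n fun k hk => ?_
  have hx := one_lt_growth (N := N) (by omega)
  have he := Real.one_le_exp (zero_le_one (α := ℝ))
  rw [tilted, inv_pow, inv_mul_eq_div, le_div_iff₀ (by positivity), one_mul]
  cases k with
  | zero => simp
  | succ k =>
    calc growth N ^ (k + 1) ≤ growth N ^ N := pow_le_pow_right₀ hx.le hk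
      _ = Real.exp 1 := growth_pow (by omega)
      _ ≤ _ := by
        push_cast
        nlinarith [mul_nonneg (sub_nonneg.2 he) (Nat.cast_nonneg (α := ℝ) k)]

/-- Let `S` be the weighted number of visits to the top and `η` the leftover. Up to multiples of
`η`, `defect N` times the gain `S / N` is `1`, and `defect N` times the bound for the energy is
`growth N / e`. So it suffices that `C * growth N < e` and that `η` is small. -/
theorem exists_gain_gt {C : ℝ} (hC0 : 0 ≤ C) (hC : C < Real.exp 1) : ∃ N n : ℕ, 2 ≤ N ∧
    C * walkMean N n n (fun _ => 1) <
      1 / N * ∑ m ∈ Finset.range n, walkMean N n m (top N) := by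
  obtain ⟨N, hN, hCN⟩ : ∃ N : ℕ, 2 ≤ N ∧ C * growth N < Real.exp 1 := by
    have h : Filter.Tendsto (fun N : ℕ => C * Real.exp (1 / (N : ℝ))) Filter.atTop
        (nhds (C * Real.exp 0)) :=
      ((Real.continuous_exp.tendsto 0).comp tendsto_one_div_atTop_nhds_zero_nat).const_mul C
    rw [Real.exp_zero, mul_one] at h
    obtain ⟨N, h1, h2⟩ := ((Filter.eventually_ge_atTop 2).and
      (h.eventually (gt_mem_nhds hC))).exists
    exact ⟨N, h1, h2⟩
  have hN0 : (0 : ℝ) < N := by positivity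
  have hW := defect_pos hN
  have hx := one_lt_growth (N := N) (by omega)
  have he0 := Real.exp_pos 1
  have he := Real.one_le_exp (zero_le_one (α := ℝ))
  set B : ℝ := (growth N)⁻¹ ^ N with hB
  have hBe : B * Real.exp 1 = 1 := by
    rw [hB, ← growth_pow (N := N) (by omega), inv_pow, inv_mul_cancel₀ (by positivity)]
  have hB0 : 0 < B := by positivity
  have hgap : 0 < 1 - C * (B * growth N) := by
    have := mul_lt_mul_of_pos_left hCN hB0
    rw [hBe] at this
    linarith
  -- The total coefficient of `η` in the errors of both sides.
  set c := C * (defect N * (Real.exp 1 - 1)) + Real.exp 1 / N with hc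
  have hc0 : 0 < c := add_pos_of_nonneg_of_pos
    (mul_nonneg hC0 (mul_nonneg hW.le (by linarith))) (by positivity)
  obtain ⟨n, hn⟩ := exists_walkMean_lt hN (div_pos hgap hc0)
  refine ⟨N, n, hN, ?_⟩
  have h0 : 0 ≤ walkMean N n n (tilted N fun k => 0 + 1 * k) := by
    have := walkMean_mono (n := n) hN n (φ := fun k => 0 * top N k)
      (ψ := tilted N fun k => 0 + 1 * k)
      fun k _ => by simp only [tilted]; rw [zero_mul]; positivity
    rwa [walkMean_mul, zero_mul] at this
  have h1 := walkMean_one_le hN n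
  have hlin := walkMean_linear (n := n) hN 0 1 le_rfl
  rw [walkMean_linear hN _ _ le_rfl] at h1
  rw [lt_div_iff₀ hc0] at hn
  set S := ∑ m ∈ Finset.range n, walkMean N n m (top N)
  set η := walkMean N n n (tilted N fun k => 0 + 1 * k)
  have hlin' : η = B * (N - defect N * S) := by rw [hlin, defect]; ring
  have h1' : walkMean N n n (fun _ => 1) ≤
      B * (1 + (growth N - 1) * S) + (Real.exp 1 - 1) * η := by
    refine h1.trans (le_of_eq ?_)
    rw [hlin', defect]; ring
  have hS : defect N * (1 / N * S) = 1 - Real.exp 1 / N * η := by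
    rw [hlin']
    field_simp
    linear_combination (N - defect N * S) * hBe
  have hH : defect N * (B * (1 + (growth N - 1) * S) + (Real.exp 1 - 1) * η) =
      B * growth N + defect N * (Real.exp 1 - 1) * η - (growth N - 1) * η := by
    rw [hlin', defect]; ring
  refine lt_of_mul_lt_mul_left (a := defect N) ?_ hW.le
  rw [hS]
  have h2 := mul_le_mul_of_nonneg_left h1' (mul_nonneg hC0 hW.le)
  have h3 : 0 ≤ C * ((growth N - 1) * η) :=
    mul_nonneg hC0 (mul_nonneg (by linarith) h0)
  have h4 : C * defect N * (B * (1 + (growth N - 1) * S) + (Real.exp 1 - 1) * η) =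
      C * (B * growth N + defect N * (Real.exp 1 - 1) * η - (growth N - 1) * η) := by
    rw [← hH]; ring
  rw [hc] at hn
  linarith

/-! The supermartingale of the example. -/

/-- The supermartingale of the walk. -/
noncomputable def walkM (N n : ℕ) (I : FourAdic) : ℝ := (state N n I).1 / N

theorem walkM_child (I : FourAdic) (j : Fin 4) : walkM N n (I.child j) =
    if I.level < n then ((walkStep N (state N n I) j).1 : ℝ) / N else 0 := by
  rw [walkM, state_child]
  split_ifs <;> simp

/-- The steps of `k` are symmetric on the right half and zero on the left half, so the mean changes
only through the forced drop at `k = N`. -/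
theorem walkM_means (hN : 2 ≤ N) {I : FourAdic} (hI : I.level < n) :
    xMean (walkM N n) I = walkM N n I - 1 / N * top N (state N n I).1 ∧
    yMean (walkM N n) I = walkM N n I - 1 / N * top N (state N n I).1 := by
  have hk := state_fst_le (n := n) hN I
  have hN0 : (N : ℝ) ≠ 0 := by positivity
  rw [show walkM N n I = (state N n I).1 / N from rfl]
  simp only [xMean, yMean, xPlus, xMinus, yPlus, yMinus, walkM_child, hI, if_true]
  generalize state N n I = s at *
  obtain ⟨k, z⟩ := s
  simp only at hk ⊢
  rcases Nat.eq_zero_or_pos k with rfl | hk0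
  · simp [walkStep, top]
    omega
  obtain ⟨l, rfl⟩ := Nat.exists_eq_add_of_le' hN
  rcases hk.eq_or_lt with rfl | hk
  · simp [walkStep, top]
    constructor <;> ring
  · obtain ⟨i, rfl⟩ := Nat.exists_eq_add_of_le' hk0
    have h : min (i + 1) (l + 2 - 1) = i + 1 := by omega
    simp only [walkStep, h, top, hk.ne]
    simp
    ring

theorem walkM_means_of_le {I : FourAdic} (hI : n ≤ I.level) :
    xMean (walkM N n) I = 0 ∧ yMean (walkM N n) I = 0 := by
  simp [xMean, yMean, xPlus, xMinus, yPlus, yMinus, walkM_child, hI.not_gt]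

theorem walkM_nonneg (I : FourAdic) : 0 ≤ walkM N n I := by
  unfold walkM; positivity

theorem walkM_le_one (hN : 2 ≤ N) (I : FourAdic) : walkM N n I ≤ 1 :=
  div_le_one_of_le₀ (by exact_mod_cast state_fst_le hN I) (by positivity)

theorem walkM_eq_zero {I : FourAdic} (hI : n + 1 ≤ I.level) : walkM N n I = 0 := by
  rw [walkM, state_fst_eq_zero hI]; simp

theorem isSlicedSupermartingale_walkM (hN : 2 ≤ N) : IsSlicedSupermartingale (walkM N n) := by
  intro I
  rcases Nat.lt_or_ge I.level n with hI | hI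
  · have h := walkM_means hN hI
    refine ⟨h.1.trans h.2.symm, ?_⟩
    rw [h.1]
    have : 0 ≤ 1 / N * top N (state N n I).1 := by unfold top; positivity
    linarith
  · have h := walkM_means_of_le (N := N) hI
    exact ⟨h.1.trans h.2.symm, h.1.trans_le (walkM_nonneg I)⟩

theorem rieszWeight_walkM (hN : 2 ≤ N) {I : FourAdic} (hI : I.level < n) :
    rieszWeight (walkM N n) I = I.length * (1 / N * top N (state N n I).1) := by
  rw [rieszWeight, dyLaplacian, (walkM_means hN hI).1]
  ring

/-! The function of the example. -/

/-- The value at `t` of the stopped walk. -/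
noncomputable def walkF (N n : ℕ) (t : ℝ) : ℂ := (walk N n n ⌊4 ^ n * t⌋₊).2

/-- After level `n` the second coordinate is frozen, hence depends only on the ancestor at level
`n`. -/
theorem walk_add (d p : ℕ) : (walk N n (n + d) p).2 = (walk N n n (p / 4 ^ d)).2 := by
  induction d generalizing p with
  | zero => simp
  | succ d ih =>
    rw [← add_assoc, walk, if_neg (by omega)]
    simp only [ih, Nat.div_div_eq_div_mul, pow_succ']

theorem floor_of_mem_toSet {I : FourAdic} (hI : n ≤ I.level) {t : ℝ} (ht : t ∈ I.toSet) :
    ⌊4 ^ n * t⌋₊ = I.pos / 4 ^ (I.level - n) := by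
  obtain ⟨d, hd⟩ := Nat.exists_eq_add_of_le hI
  rw [toSet_eq, hd] at ht
  obtain ⟨h1, h2⟩ := ht
  rw [hd, Nat.add_sub_cancel_left]
  have h4 : (0 : ℝ) < 4 ^ d := by positivity
  rw [div_le_iff₀ (by positivity), pow_add] at h1
  rw [lt_div_iff₀ (by positivity), pow_add] at h2
  set q := I.pos / 4 ^ d with hq
  have hq1 : q * 4 ^ d ≤ I.pos := Nat.div_mul_le_self _ _
  have hq2 : I.pos + 1 ≤ (q + 1) * 4 ^ d := Nat.lt_mul_of_div_lt (Nat.lt_succ_self _) (by positivity)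
  have hq1' : (q : ℝ) * 4 ^ d ≤ I.pos := by exact_mod_cast hq1
  have hq2' : ((I.pos + 1 : ℕ) : ℝ) ≤ (q + 1) * 4 ^ d := by exact_mod_cast hq2
  have ht0 : 0 ≤ (4 : ℝ) ^ n * t := by
    have : (0 : ℝ) ≤ 4 ^ d * (4 ^ n * t) := by
      have := Nat.cast_nonneg (α := ℝ) I.pos
      linarith
    exact (mul_nonneg_iff_of_pos_left h4).1 this
  rw [Nat.floor_eq_iff ht0]
  constructor
  · refine le_of_mul_le_mul_left ?_ h4
    linarith
  · refine lt_of_mul_lt_mul_left ?_ h4.le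
    linarith

theorem walkF_eq {I : FourAdic} (hI : n ≤ I.level) {t : ℝ} (ht : t ∈ I.toSet) :
    walkF N n t = (state N n I).2 := by
  obtain ⟨d, hd⟩ := Nat.exists_eq_add_of_le hI
  rw [walkF, floor_of_mem_toSet hI ht, state, hd, walk_add, Nat.add_sub_cancel_left]

theorem memLp_walkF (φ : ℂ → ℝ) :
    MemLp (fun t => φ (walkF N n t)) 2 (volume.restrict (Set.Ico 0 1)) := by
  obtain ⟨c, hc⟩ := ((Finset.range (4 ^ n)).image fun k => ‖φ (walk N n n k).2‖).exists_le
  have hm : Measurable fun t : ℝ => φ (walkF N n t) :=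
    (measurable_from_nat (f := fun k => φ (walk N n n k).2)).comp
      (Nat.measurable_floor.comp (measurable_const_mul _))
  refine MemLp.of_bound hm.aestronglyMeasurable c ?_
  filter_upwards [ae_restrict_mem measurableSet_Ico] with t ht
  refine hc _ (Finset.mem_image.2 ⟨⌊4 ^ n * t⌋₊, Finset.mem_range.2 ?_, rfl⟩)
  rw [Nat.floor_lt (mul_nonneg (by positivity) ht.1)]
  push_cast
  exact mul_lt_of_lt_one_right (by positivity) ht.2

/-- The complex form of the sliced martingale property and the Cauchy-Riemann equations; `d = 0`
once the walk is absorbed or stopped. -/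
theorem state_snd_child (I : FourAdic) : ∃ d : ℂ,
    (state N n (I.child 0)).2 = (state N n I).2 - d * Complex.I ∧
    (state N n (I.child 1)).2 = (state N n I).2 + d * Complex.I ∧
    (state N n (I.child 2)).2 = (state N n I).2 - d ∧
    (state N n (I.child 3)).2 = (state N n I).2 + d := by
  simp only [state_child]
  by_cases h : I.level < n ∧ (state N n I).1 ≠ 0
  · refine ⟨(state N n I).2 * tilt N, ?_⟩
    simp only [h.1, h.2, walkStep, if_true, if_false, Fin.isValue, Fin.coe_ofNat_eq_mod,
      Nat.zero_mod, Nat.one_mod, Nat.reduceMod]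
    refine ⟨?_, ?_, ?_, ?_⟩ <;> ring
  · refine ⟨0, ?_⟩
    by_cases h1 : I.level < n
    · have h2 : (state N n I).1 = 0 := by tauto
      simp [h1, h2, walkStep]
    · simp [h1]

theorem avg_walkF (φ : ℂ →ₗ[ℝ] ℝ) (I : FourAdic) :
    avg (fun t => φ (walkF N n t)) I = φ (state N n I).2 := by
  induction I using child_induction n with
  | base I hI => exact avg_eq_of_eqOn fun t ht => by rw [walkF_eq hI ht]
  | step I hI ih =>
    have hint : IntegrableOn (fun t => φ (walkF N n t)) (Set.Ico 0 1) := by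
      have : IsFiniteMeasure (volume.restrict (Set.Ico (0 : ℝ) 1)) := ⟨by simp⟩
      exact (memLp_walkF φ).integrable (by norm_num)
    rw [avg_eq_sum hint, Fin.sum_univ_four, ih, ih, ih, ih]
    obtain ⟨d, h0, h1, h2, h3⟩ := state_snd_child (N := N) (n := n) I
    rw [h0, h1, h2, h3]
    simp only [map_add, map_sub]
    ring

theorem avg_re_walkF : avg (fun t => (walkF N n t).re) = fun I => (state N n I).2.re :=
  funext fun I => avg_walkF Complex.reLm I

theorem avg_im_walkF : avg (fun t => (walkF N n t).im) = fun I => (state N n I).2.im :=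
  funext fun I => avg_walkF Complex.imLm I

theorem memHardy_walkF : MemHardy (fun t => (walkF N n t).re) fun t => (walkF N n t).im where
  memLp_re := memLp_walkF Complex.re
  memLp_im := memLp_walkF Complex.im
  sliced_re I := by
    obtain ⟨d, h0, h1, h2, h3⟩ := state_snd_child (N := N) (n := n) I
    simp [avg_re_walkF, xMean, yMean, xPlus, xMinus, yPlus, yMinus, h0, h1, h2, h3]
    ring
  sliced_im I := by
    obtain ⟨d, h0, h1, h2, h3⟩ := state_snd_child (N := N) (n := n) I
    simp [avg_im_walkF, xMean, yMean, xPlus, xMinus, yPlus, yMinus, h0, h1, h2, h3]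
  cauchyRiemann I := by
    obtain ⟨d, h0, h1, h2, h3⟩ := state_snd_child (N := N) (n := n) I
    simp [avg_re_walkF, avg_im_walkF, deltaX, deltaY, xPlus, xMinus, yPlus, yMinus, h0, h1, h2,
      h3]
    ring

theorem hardyNormSq_walkF : hardyNormSq (fun t => (walkF N n t).re) (fun t => (walkF N n t).im) =
    walkMean N n n fun _ => 1 := by
  rw [hardyNormSq, ← levelSum_integral memHardy_walkF.integrable_sq_add n]
  refine levelSum_congr fun I hI => ?_
  have h : Set.EqOn (fun t => (walkF N n t).re ^ 2 + (walkF N n t).im ^ 2)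
      (fun _ => Complex.normSq (state N n I).2) I.toSet := fun t ht => by
    simp only [walkF_eq hI.ge ht, Complex.normSq_apply]
    ring
  rw [setIntegral_congr_fun (measurableSet_toSet I) h, setIntegral_const, volume_toSet, one_mul,
    smul_eq_mul]

theorem exists_extremal {C : ℝ} (hC0 : 0 ≤ C) (hC : C < Real.exp 1) :
    ∃ μ : FourAdic → ℝ, IsBalanced μ ∧ Packing μ 1 ∧
      ∃ u v : ℝ → ℝ, MemHardy u v ∧ avg v root = 0 ∧
        C * hardyNormSq u v < ∑' I, μ I * (avg u I ^ 2 + avg v I ^ 2) := by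
  obtain ⟨N, n, hN, h⟩ := exists_gain_gt hC0 hC
  have hM := isSlicedSupermartingale_walkM (n := n) hN
  obtain ⟨hbal, hmean⟩ := isBalanced_rieszWeight hM fun I hI => walkM_eq_zero hI
  refine ⟨rieszWeight (walkM N n), hbal, fun I => ?_, _, _, memHardy_walkF (N := N) (n := n), ?_,
    ?_⟩
  · exact (congrFun hmean I).trans_le (walkM_le_one hN I)
  · simp [avg_im_walkF, state_root]
  · rw [hardyNormSq_walkF]
    refine h.trans_le ?_
    have hsum := (embedding_of_le_one hM walkM_nonneg (walkM_le_one hN)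
      (memHardy_walkF (N := N) (n := n))).1
    -- The mass at level `n`, where `M` is cut to zero, is non-negative and is discarded.
    refine le_trans (le_of_eq ?_) (hsum.sum_le_tsum (below n)
      fun I _ => mul_nonneg (hbal.nonneg I) (by positivity))
    rw [sum_below, Finset.mul_sum]
    refine Finset.sum_congr rfl fun m hm => ?_
    rw [walkMean, ← levelSum_const_mul]
    refine levelSum_congr fun I hI => ?_
    rw [rieszWeight_walkM hN (hI.trans_lt (Finset.mem_range.1 hm)), avg_re_walkF, avg_im_walkF,
      Complex.normSq_apply]
    ring

end DyadicHardy

/-! ### The four statements -/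

open DyadicHardy
theorem mainTheorem1 :
    -- the embedding for a bounded non-negative sliced supermartingale
    (∀ M : FourAdic → ℝ, IsSlicedSupermartingale M → (∀ I, 0 ≤ M I) → BddAbove (Set.range M) →
      ∀ u v : ℝ → ℝ, MemHardy u v →
        Summable (fun I => rieszWeight M I * (avg u I ^ 2 + avg v I ^ 2)) ∧
        ∑' I, rieszWeight M I * (avg u I ^ 2 + avg v I ^ 2) ≤
          Real.exp 1 * (⨆ I, |M I|) * hardyNormSq u v) ∧
    -- its constant is sharp
    (∀ C : ℝ, C < Real.exp 1 →
      ∃ M : FourAdic → ℝ, IsSlicedSupermartingale M ∧ (∀ I, 0 ≤ M I) ∧ BddAbove (Set.range M) ∧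
      ∃ u v : ℝ → ℝ, MemHardy u v ∧ avg v FourAdic.root = 0 ∧
        C * (⨆ I, |M I|) * hardyNormSq u v <
          ∑' I, rieszWeight M I * (avg u I ^ 2 + avg v I ^ 2)) ∧
    -- the embedding for a balanced sequence with a packing condition
    (∀ (μ : FourAdic → ℝ) (K : ℝ), IsBalanced μ → Packing μ K →
      ∀ u v : ℝ → ℝ, MemHardy u v →
        Summable (fun I => μ I * (avg u I ^ 2 + avg v I ^ 2)) ∧
        ∑' I, μ I * (avg u I ^ 2 + avg v I ^ 2) ≤ Real.exp 1 * K * hardyNormSq u v) ∧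
    -- its constant is sharp
    (∀ C : ℝ, C < Real.exp 1 →
      ∃ (μ : FourAdic → ℝ) (K : ℝ), IsBalanced μ ∧ Packing μ K ∧
      ∃ u v : ℝ → ℝ, MemHardy u v ∧ avg v FourAdic.root = 0 ∧
        C * K * hardyNormSq u v < ∑' I, μ I * (avg u I ^ 2 + avg v I ^ 2)) := by
  have packing : ∀ (μ : FourAdic → ℝ) (K : ℝ), IsBalanced μ → Packing μ K →
      ∀ u v : ℝ → ℝ, MemHardy u v →
        Summable (fun I => μ I * (avg u I ^ 2 + avg v I ^ 2)) ∧
        ∑' I, μ I * (avg u I ^ 2 + avg v I ^ 2) ≤ Real.exp 1 * K * hardyNormSq u v := by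
    intro μ K hμ hK u v h
    have := embedding_of_le hμ.isSlicedSupermartingale (meanMass_nonneg hμ.nonneg) hK h
    rwa [hμ.rieszWeight_meanMass] at this
  have norm_nonneg : ∀ u v : ℝ → ℝ, 0 ≤ hardyNormSq u v := fun u v =>
    integral_nonneg fun t => add_nonneg (sq_nonneg _) (sq_nonneg _)
  refine ⟨fun M hM hM0 hb u v h => ?_, fun C hC => ?_, packing, fun C hC => ?_⟩
  · have habs : (fun I => |M I|) = M := funext fun I => abs_of_nonneg (hM0 I)
    rw [habs]
    exact embedding_of_le hM hM0 (le_ciSup hb) h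
  · obtain ⟨μ, hμ, hK, u, v, h, hv, hlt⟩ :=
      exists_extremal (le_max_right C 0) (max_lt hC (Real.exp_pos 1))
    have hM0 := meanMass_nonneg hμ.nonneg
    have hb : BddAbove (Set.range (meanMass μ)) := ⟨1, by rintro _ ⟨I, rfl⟩; exact hK I⟩
    refine ⟨meanMass μ, hμ.isSlicedSupermartingale, hM0, hb, u, v, h, hv, ?_⟩
    rw [hμ.rieszWeight_meanMass]
    refine lt_of_le_of_lt (mul_le_mul_of_nonneg_right ?_ (norm_nonneg u v)) hlt
    have h1 : ⨆ I, |meanMass μ I| ≤ 1 := by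
      have : Nonempty FourAdic := ⟨FourAdic.root⟩
      exact ciSup_le fun I => (abs_of_nonneg (hM0 I)).trans_le (hK I)
    have h0 : 0 ≤ ⨆ I, |meanMass μ I| := Real.iSup_nonneg fun I => abs_nonneg _
    exact (mul_le_mul_of_nonneg_right (le_max_left C 0) h0).trans
      (mul_le_of_le_one_right (le_max_right C 0) h1)
  · obtain ⟨μ, hμ, hK, u, v, h, hv, hlt⟩ :=
      exists_extremal (le_max_right C 0) (max_lt hC (Real.exp_pos 1))
    refine ⟨μ, 1, hμ, hK, u, v, h, hv, ?_⟩
    rw [mul_one]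
    exact lt_of_le_of_lt (mul_le_mul_of_nonneg_right (le_max_left C 0) (norm_nonneg u v)) hlt
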